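/- A (group) word on a set $X$ of variables is an element $w$ of the free group $F(X)$. For a group $G$, let $w\{G\}$ be the set of all values of $w$ in $G$, i.e. the images of $w$ under the homomorphisms $F(X)\to G$, and let $w(G)=\langle w\{G\}\rangle$ be the verbal subgroup. The word $w$ is concise if, for every group $G$, finiteness of $w\{G\}$ implies finiteness of $w(G)$; it is boundedly concise if there is a function $f:\mathbb{N}\to\mathbb{N}$ (depending only on $w$) such that, for every group $G$ with $w\{G\}$ finite, $w(G)$ is finite and $|w(G)|\le f(|w\{G\}|)$. Outer commutator words are defined recursively: single variables are outer commutator words, and if $\alpha$ and $\beta$ are outer commutator words in disjoint sets of variables then $[\alpha,\beta]=\alpha\beta\alpha^{-1}\beta^{-1}$ is an outer commutator word. A word is a non-commutator word if it lies outside the derived subgroup of the free group, i.e. its exponent sum in at least one variable is nonzero. Theorem. Let $w=w(x_1,\dots,x_r)$ be an outer commutator word whose variables are exactly $x_1,\dots,x_r$, and let $u_1,\dots,u_r$ be non-commutator words in pairwise disjoint sets of variables. Then the word $w(u_1,\dots,u_r)$ is concise, and in fact boundedly concise. In particular, for all nonzero integers $n_1,\dots,n_r$, the word $w(x_1^{n_1},\dots,x_r^{n_r})$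 is concise and boundedly concise. -/

import Mathlib

universe u v

namespace GroupWord

/-- `IsOuterCommutator S w`: the group word `w` is an outer commutator word whose set of
variables is exactly `S`.  Single variables are outer commutator words, and if `α` and `β` are
outer commutator words in disjoint sets of variables then so is `[α, β] = α β α⁻¹ β⁻¹`. -/
inductive IsOuterCommutator {X : Type u} : Set X → FreeGroup X → Prop
  | var (x : X) : IsOuterCommutator {x} (FreeGroup.of x)
  | comm {S T : Set X} {α β : FreeGroup X} (hα : IsOuterCommutator S α)
      (hβ : IsOuterCommutator T β) (hST : Disjoint S T) : IsOuterCommutator (S ∪ T) (α * β * α⁻¹ * β⁻¹)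

/-- A non-commutator word is a word lying outside the derived subgroup of the free group. -/
def IsNonCommutator {X : Type u} (w : FreeGroup X) : Prop :=
  w ∉ commutator (FreeGroup X)

/-- The words `w i` can be written in pairwise disjoint sets of variables. -/
def InDisjointVariables {ι : Type*} {X : Type u} (w : ι → FreeGroup X) : Prop :=
  ∃ S : ι → Set X, Pairwise (fun i j => Disjoint (S i) (S j)) ∧
    ∀ i, w i ∈ Subgroup.closure (FreeGroup.of '' S i)

/-- The set `w{G}` of all values of the word `w` in the group `G`. -/
def values {X : Type u} (w : FreeGroup X) (G : Type v) [Group G] : Set G :=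
  Set.range fun g : X → G => FreeGroup.lift g w

/-- The verbal subgroup `w(G)`, generated by all values of `w` in `G`. -/
def verbalSubgroup {X : Type u} (w : FreeGroup X) (G : Type v) [Group G] : Subgroup G :=
  Subgroup.closure (values w G)

/-- `w` is concise: in every group `G`, if `w{G}` is finite then `w(G)` is finite. -/
def IsConcise.{a, b} {X : Type a} (w : FreeGroup X) : Prop :=
  ∀ (G : Type b) [Group G], (values w G).Finite → Finite (verbalSubgroup w G)

/-- `w` is boundedly concise: in every group `G` in which `w{G}` is finite, `w(G)` is finite of
order bounded by a function (depending only on `w`) of the cardinality of `w{G}`. -/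
def IsBoundedlyConcise.{a, b} {X : Type a} (w : FreeGroup X) : Prop :=
  ∃ f : ℕ → ℕ, ∀ (G : Type b) [Group G], (values w G).Finite →
    Finite (verbalSubgroup w G) ∧ Nat.card (verbalSubgroup w G) ≤ f (values w G).ncard

end GroupWord

/-! The values of the word form a finite normal subset; let `H` be the subgroup it generates.
Finitely many conjugation actions on this set give finitely many commutators in `H`, so `commutator
H` is finite, and `H` is finite once every homomorphism φ from `H` to a torsion-free abelian group
is zero (`finite_closure_of_forall_eq_zero`).

`IsOuterCommutator.eq_zero_of_finite_image` proves this vanishing by induction on the outer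
commutator word, assuming only that φ has finitely many values on the word values; non-commutator
words enter through the powers among their values. For [α, β], conjugating one entry by `g ^ k`
makes φ affine in `k`, and finiteness kills the slope. The resulting invariance makes φ([x, y])
additive in an entry, so induction applies.

The bound follows by compactness, in an ultraproduct. -/

namespace GroupWord

/-! ### Values with restricted substitutions -/

section ValuesOn

variable {ι G : Type*} [Group G]

/-- The values of the word `w` under substitutions with the `i`-th variable taken from `S i`. -/
def valuesOn (S : ι → Set G) (w : FreeGroup ι) : Set G :=
  {g | ∃ c : ι → G, (∀ i, c i ∈ S i) ∧ FreeGroup.lift c w = g}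

theorem conj_mem_valuesOn {S : ι → Set G} (hS : ∀ i g, ∀ s ∈ S i, g * s * g⁻¹ ∈ S i)
    (w : FreeGroup ι) (g : G) {x : G} (hx : x ∈ valuesOn S w) : g * x * g⁻¹ ∈ valuesOn S w := by
  obtain ⟨c, hc, rfl⟩ := hx
  refine ⟨fun i => g * c i * g⁻¹, fun i => hS i g _ (hc i), ?_⟩
  have h : FreeGroup.lift (fun i => g * c i * g⁻¹) =
      (MulAut.conj g).toMonoidHom.comp (FreeGroup.lift c) := by
    ext i; simp
  simp [h]

theorem IsOuterCommutator.lift_congr {V : Set ι} {w : FreeGroup ι} (hw : IsOuterCommutator V w)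
    {c d : ι → G} (h : ∀ i ∈ V, c i = d i) : FreeGroup.lift c w = FreeGroup.lift d w := by
  induction hw with
  | var i => simpa using h i rfl
  | comm _ _ _ ihα ihβ =>
    simp only [map_mul, map_inv, ihα fun i hi => h i (Or.inl hi), ihβ fun i hi => h i (Or.inr hi)]

/-- Since the variables are disjoint, substitutions for α and β can be glued into one. -/
theorem IsOuterCommutator.mem_valuesOn_comm {S : ι → Set G} {V W : Set ι} {α β : FreeGroup ι}
    (hα : IsOuterCommutator V α) (hβ : IsOuterCommutator W β) (hVW : Disjoint V W) {g : G} :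
    g ∈ valuesOn S (α * β * α⁻¹ * β⁻¹) ↔
      ∃ x ∈ valuesOn S α, ∃ y ∈ valuesOn S β, x * y * x⁻¹ * y⁻¹ = g := by
  classical
  constructor
  · rintro ⟨c, hc, rfl⟩
    exact ⟨_, ⟨c, hc, rfl⟩, _, ⟨c, hc, rfl⟩, by simp⟩
  · rintro ⟨_, ⟨c, hc, rfl⟩, _, ⟨d, hd, rfl⟩, rfl⟩
    refine ⟨fun i => if i ∈ V then c i else d i, fun i => ?_, ?_⟩
    · dsimp only
      split_ifs
      exacts [hc i, hd i]
    · have h1 := hα.lift_congr (c := fun i => if i ∈ V then c i else d i) (d := c)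
        fun i hi => if_pos hi
      have h2 := hβ.lift_congr (c := fun i => if i ∈ V then c i else d i) (d := d)
        fun i hi => if_neg fun hi' => Set.disjoint_left.1 hVW hi' hi
      simp only [map_mul, map_inv, h1, h2]

end ValuesOn

/-! ### Vanishing of homomorphisms to torsion-free groups -/

section AdditiveFunctions

theorem invariant_of_closure {G T : Type*} [Group G] {H : Subgroup G} [H.Normal]
    {s : Set G} {φ : G → T} (hs : ∀ x ∈ s, ∀ g ∈ H, φ (x * g * x⁻¹) = φ g)
    {p : G} (hp : p ∈ Subgroup.closure s) :
    ∀ g ∈ H, φ (p * g * p⁻¹) = φ g := by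
  induction hp using Subgroup.closure_induction with
  | mem x hx => exact hs x hx
  | one => simp
  | mul x y _ _ ihx ihy =>
    intro g hg
    rw [← ihy g hg, ← ihx _ (Subgroup.Normal.conj_mem ‹_› g hg y)]
    congr 1; group
  | inv x _ ihx =>
    intro g hg
    rw [← ihx (x⁻¹ * g * x⁻¹⁻¹) (Subgroup.Normal.conj_mem ‹_› g hg x⁻¹)]
    congr 1; group

variable {G T : Type*} [Group G] [AddCommGroup T]

/-- `φ` restricts to a homomorphism from the subgroup `H` to the additive group `T`. -/
def IsAdditiveOn (H : Subgroup G) (φ : G → T) : Prop :=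
  ∀ a ∈ H, ∀ b ∈ H, φ (a * b) = φ a + φ b

namespace IsAdditiveOn

variable {H : Subgroup G} {φ : G → T}

theorem map_one (h : IsAdditiveOn H φ) : φ 1 = 0 := by
  simpa using h 1 H.one_mem 1 H.one_mem

theorem map_inv (h : IsAdditiveOn H φ) {a : G} (ha : a ∈ H) : φ a⁻¹ = -φ a := by
  have := h a⁻¹ (H.inv_mem ha) a ha
  rw [inv_mul_cancel, h.map_one] at this
  exact eq_neg_of_add_eq_zero_left this.symm

theorem map_pow (h : IsAdditiveOn H φ) {a : G} (ha : a ∈ H) (n : ℕ) : φ (a ^ n) = n • φ a := by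
  induction n with
  | zero => simpa using h.map_one
  | succ n ih => rw [pow_succ, h _ (H.pow_mem ha n) _ ha, ih, succ_nsmul]

theorem map_zpow (h : IsAdditiveOn H φ) {a : G} (ha : a ∈ H) (n : ℤ) : φ (a ^ n) = n • φ a := by
  obtain ⟨n, rfl | rfl⟩ := n.eq_nat_or_neg
  · simpa using h.map_pow ha n
  · rw [zpow_neg, h.map_inv (H.zpow_mem ha _), zpow_natCast, h.map_pow ha, neg_smul,
      natCast_zsmul]

theorem eq_zero_of_closure {s : Set G} (h : IsAdditiveOn (Subgroup.closure s) φ)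
    (hs : ∀ x ∈ s, φ x = 0) {a : G} (ha : a ∈ Subgroup.closure s) : φ a = 0 := by
  induction ha using Subgroup.closure_induction with
  | mem x hx => exact hs x hx
  | one => exact h.map_one
  | mul x y hx hy ihx ihy => rw [h x hx y hy, ihx, ihy, add_zero]
  | inv x hx ihx => rw [h.map_inv hx, ihx, neg_zero]

end IsAdditiveOn

theorem eq_zero_of_finite_affine [IsAddTorsionFree T] {A : Set T} (hA : A.Finite) {e t : T}
    (h : ∀ k : ℕ, k • e + t ∈ A) : e = 0 := by
  by_contra he
  refine Set.infinite_of_injective_forall_mem (f := fun k : ℕ => k • e + t) ?_ h hA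
  intro k l hkl
  by_contra hne
  have h1 : k • e = l • e := add_right_cancel hkl
  have h2 : ((k : ℤ) - l) • e = 0 := by simp [sub_smul, h1]
  rcases smul_eq_zero.1 h2 with h3 | h3
  · omega
  · exact he h3

theorem closure_normal_of_conj_mem {s : Set G} (hs : ∀ g, ∀ x ∈ s, g * x * g⁻¹ ∈ s) :
    (Subgroup.closure s).Normal := by
  refine ⟨fun a ha g => ?_⟩
  induction ha using Subgroup.closure_induction with
  | mem x hx => exact Subgroup.subset_closure (hs g x hx)
  | one => simp
  | mul x y _ _ ihx ihy =>
    convert Subgroup.mul_mem _ ihx ihy using 1; group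
  | inv x _ ihx =>
    convert Subgroup.inv_mem _ ihx using 1; group

theorem comm_mem_of_mem_closure_left {H : Subgroup G} [H.Normal] {s : Set G} {y : G}
    (h : ∀ x ∈ s, x * y * x⁻¹ * y⁻¹ ∈ H) {p : G} (hp : p ∈ Subgroup.closure s) :
    p * y * p⁻¹ * y⁻¹ ∈ H := by
  induction hp using Subgroup.closure_induction with
  | mem x hx => exact h x hx
  | one => simp
  | mul a b _ _ iha ihb =>
    convert H.mul_mem (Subgroup.Normal.conj_mem ‹_› _ ihb a) iha using 1; group
  | inv a _ iha =>
    convert Subgroup.Normal.conj_mem ‹_› _ (H.inv_mem iha) a⁻¹ using 1; group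

theorem comm_mem_of_mem_closure_right {H : Subgroup G} [H.Normal] {s : Set G} {x : G}
    (h : ∀ y ∈ s, x * y * x⁻¹ * y⁻¹ ∈ H) {q : G} (hq : q ∈ Subgroup.closure s) :
    x * q * x⁻¹ * q⁻¹ ∈ H := by
  have := comm_mem_of_mem_closure_left (H := H) (s := s) (y := x) (fun y hy => by
    convert H.inv_mem (h y hy) using 1; group) hq
  convert H.inv_mem this using 1; group

/-- If `φ` takes finitely many values on the commutators `[x, y]` with `x ∈ s` and `y ∈ t`, where
`s` and `t` are normal subsets, then `(1 - z) (1 - x)` annihilates `φ`. -/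
theorem second_difference_eq_zero [IsAddTorsionFree T] {H : Subgroup G} [H.Normal] {s t : Set G}
    (hs : ∀ g, ∀ x ∈ s, g * x * g⁻¹ ∈ s) (ht : ∀ g, ∀ y ∈ t, g * y * g⁻¹ ∈ t)
    (hH : ∀ x ∈ s, ∀ y ∈ t, x * y * x⁻¹ * y⁻¹ ∈ H)
    {φ : G → T} (hφ : IsAdditiveOn H φ) {A : Set T} (hA : A.Finite)
    (hφA : ∀ x ∈ s, ∀ y ∈ t, φ (x * y * x⁻¹ * y⁻¹) ∈ A)
    {x z g : G} (hx : x ∈ s) (hz : z ∈ t) (hg : g ∈ H) :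
    φ g - φ (z * g * z⁻¹) - (φ (x * g * x⁻¹) - φ (z * (x * g * x⁻¹) * z⁻¹)) = 0 := by
  have hn : ∀ a ∈ H, ∀ b, b * a * b⁻¹ ∈ H := fun a ha b => Subgroup.Normal.conj_mem ‹_› a ha b
  -- Chosen so that x y x⁻¹ = z. Replacing `x` by its conjugate under `g ^ k` then adds `k` times
  -- the second difference to φ([x, y]).
  set y := x⁻¹ * z * x with hy
  have hyt : y ∈ t := by simpa using ht x⁻¹ z hz
  refine eq_zero_of_finite_affine hA (t := φ (x * y * x⁻¹ * y⁻¹)) fun k => ?_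
  have hk := H.pow_mem hg k
  have key : (g ^ k * x * (g ^ k)⁻¹) * y * (g ^ k * x * (g ^ k)⁻¹)⁻¹ * y⁻¹ =
      g ^ k * ((x * g * x⁻¹) ^ k)⁻¹ * ((z * (x * g * x⁻¹) * z⁻¹) ^ k * ((z * g * z⁻¹) ^ k)⁻¹) *
        (x * y * x⁻¹ * y⁻¹) := by
    simp only [conj_pow, hy]; group
  have h1 := hφA _ (hs (g ^ k) x hx) y hyt
  have e1 := hn _ hg x
  have e2 := hn _ hg z
  have e3 := hn _ e1 z
  rw [key, hφ _ (H.mul_mem (H.mul_mem hk (H.inv_mem (H.pow_mem e1 k)))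
      (H.mul_mem (H.pow_mem e3 k) (H.inv_mem (H.pow_mem e2 k)))) _ (hH x hx y hyt),
    hφ _ (H.mul_mem hk (H.inv_mem (H.pow_mem e1 k))) _
      (H.mul_mem (H.pow_mem e3 k) (H.inv_mem (H.pow_mem e2 k))),
    hφ _ hk _ (H.inv_mem (H.pow_mem e1 k)), hφ _ (H.pow_mem e3 k) _ (H.inv_mem (H.pow_mem e2 k)),
    hφ.map_inv (H.pow_mem e1 k), hφ.map_inv (H.pow_mem e2 k), hφ.map_pow hg, hφ.map_pow e1,
    hφ.map_pow e2, hφ.map_pow e3] at h1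
  convert h1 using 1
  simp only [smul_sub]
  abel

/-- [ab, y] = a[b, y]a⁻¹ · [a, y], and invariance removes the conjugation. -/
theorem IsAdditiveOn.comm_left {H P : Subgroup G} [H.Normal] {φ : G → T}
    (hφ : IsAdditiveOn H φ) {y : G} (hP : ∀ p ∈ P, p * y * p⁻¹ * y⁻¹ ∈ H)
    (hinv : ∀ p ∈ P, ∀ g ∈ H, φ (p * g * p⁻¹) = φ g) :
    IsAdditiveOn P fun p => φ (p * y * p⁻¹ * y⁻¹) := by
  intro a ha b hb
  have h : a * b * y * (a * b)⁻¹ * y⁻¹ =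
      a * (b * y * b⁻¹ * y⁻¹) * a⁻¹ * (a * y * a⁻¹ * y⁻¹) := by group
  dsimp only
  rw [h, hφ _ (Subgroup.Normal.conj_mem ‹_› _ (hP b hb) a) _ (hP a ha), hinv a ha _ (hP b hb),
    add_comm]

theorem IsAdditiveOn.comm_right {H Q : Subgroup G} [H.Normal] {φ : G → T}
    (hφ : IsAdditiveOn H φ) {x : G} (hQ : ∀ q ∈ Q, x * q * x⁻¹ * q⁻¹ ∈ H)
    (hinv : ∀ q ∈ Q, ∀ g ∈ H, φ (q * g * q⁻¹) = φ g) :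
    IsAdditiveOn Q fun q => φ (x * q * x⁻¹ * q⁻¹) := by
  intro a ha b hb
  have h : x * (a * b) * x⁻¹ * (a * b)⁻¹ =
      x * a * x⁻¹ * a⁻¹ * (a * (x * b * x⁻¹ * b⁻¹) * a⁻¹) := by group
  dsimp only
  rw [h, hφ _ (hQ a ha) _ (Subgroup.Normal.conj_mem ‹_› _ (hQ b hb) a), hinv a ha _ (hQ b hb)]

/-- A homomorphism from the subgroup `w(S)` to a torsion-free abelian group vanishes if it takes
only finitely many values on the values of the outer commutator word `w`. -/
theorem IsOuterCommutator.eq_zero_of_finite_image {ι : Type*} [IsAddTorsionFree T]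
    {S : ι → Set G} (hS : ∀ i g, ∀ s ∈ S i, g * s * g⁻¹ ∈ S i)
    {n : ι → ℤ} (hn : ∀ i, n i ≠ 0) (hpow : ∀ i, ∀ s ∈ S i, ∀ k : ℕ, s ^ (n i * k) ∈ S i)
    (hne : ∀ i, (S i).Nonempty)
    {V : Set ι} {w : FreeGroup ι} (hw : IsOuterCommutator V w) :
    ∀ φ : G → T, IsAdditiveOn (Subgroup.closure (valuesOn S w)) φ →
      (φ '' valuesOn S w).Finite → ∀ g ∈ Subgroup.closure (valuesOn S w), φ g = 0 := by
  classical
  induction hw with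
  | var i =>
    intro φ hφ hfin g hg
    refine hφ.eq_zero_of_closure ?_ hg
    rintro _ ⟨c, hc, rfl⟩
    set s := FreeGroup.lift c (FreeGroup.of i) with hs
    have hsi : s ∈ S i := by simpa [hs] using hc i
    have hmem : ∀ t ∈ S i, t ∈ valuesOn S (FreeGroup.of i) := by
      intro t ht
      choose d hd using hne
      refine ⟨Function.update d i t, fun j => ?_, by simp⟩
      by_cases hj : j = i
      · subst hj; simpa using ht
      · simpa [hj] using hd j
    have hsH := Subgroup.subset_closure (hmem s hsi)
    have h0 : n i • φ s = 0 := by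
      refine eq_zero_of_finite_affine hfin (t := 0) fun k => ?_
      refine ⟨s ^ (n i * k), hmem _ (hpow i s hsi k), ?_⟩
      rw [hφ.map_zpow hsH, add_zero, mul_comm, mul_smul, natCast_zsmul]
    exact (smul_eq_zero.1 h0).resolve_left (hn i)
  | @comm V W α β hα hβ hVW ihα ihβ =>
    intro φ hφ hfin
    have hmem : ∀ x ∈ valuesOn S α, ∀ y ∈ valuesOn S β,
        x * y * x⁻¹ * y⁻¹ ∈ valuesOn S (α * β * α⁻¹ * β⁻¹) := fun x hx y hy =>
      (hα.mem_valuesOn_comm hβ hVW).2 ⟨x, hx, y, hy, rfl⟩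
    have hnorm : (Subgroup.closure (valuesOn S (α * β * α⁻¹ * β⁻¹))).Normal :=
      closure_normal_of_conj_mem fun g x hx => conj_mem_valuesOn hS _ g hx
    set H := Subgroup.closure (valuesOn S (α * β * α⁻¹ * β⁻¹)) with hH
    have hconjH : ∀ a ∈ H, ∀ b, b * a * b⁻¹ ∈ H := fun a ha b => hnorm.conj_mem a ha b
    have hmemH : ∀ x ∈ valuesOn S α, ∀ y ∈ valuesOn S β, x * y * x⁻¹ * y⁻¹ ∈ H :=
      fun x hx y hy => Subgroup.subset_closure (hmem x hx y hy)
    have hsα : ∀ g, ∀ x ∈ valuesOn S α, g * x * g⁻¹ ∈ valuesOn S α :=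
      fun g x hx => conj_mem_valuesOn hS _ g hx
    have hsβ : ∀ g, ∀ x ∈ valuesOn S β, g * x * g⁻¹ ∈ valuesOn S β :=
      fun g x hx => conj_mem_valuesOn hS _ g hx
    have hdiff := fun (x z g : G) (hx : x ∈ valuesOn S α) (hz : z ∈ valuesOn S β) (hg : g ∈ H) =>
      second_difference_eq_zero hsα hsβ hmemH hφ hfin
        (fun x hx y hy => ⟨_, hmem x hx y hy, rfl⟩) hx hz hg
    -- By `hdiff`, ψ = φ - φ(z · z⁻¹) is invariant under the subgroup of α, so ψ([p, y]) is additive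
    -- in `p` and `ihα` kills ψ on generators.
    have hinv : ∀ z ∈ valuesOn S β, ∀ g ∈ H, φ (z * g * z⁻¹) = φ g := by
      intro z hz g hg
      set ψ : G → T := fun g => φ g - φ (z * g * z⁻¹) with hψ
      have hψadd : IsAdditiveOn H ψ := by
        intro a ha b hb
        simp only [hψ]
        rw [hφ a ha b hb, show z * (a * b) * z⁻¹ = z * a * z⁻¹ * (z * b * z⁻¹) by group,
          hφ _ (hconjH a ha z) _ (hconjH b hb z)]
        abel
      have hψfin : (ψ '' valuesOn S (α * β * α⁻¹ * β⁻¹)).Finite := by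
        refine (hfin.sub hfin).subset ?_
        rintro _ ⟨v, hv, rfl⟩
        exact Set.sub_mem_sub ⟨v, hv, rfl⟩ ⟨_, conj_mem_valuesOn hS _ z hv, rfl⟩
      have hψinv : ∀ p ∈ Subgroup.closure (valuesOn S α), ∀ g ∈ H, ψ (p * g * p⁻¹) = ψ g :=
        fun p hp => invariant_of_closure
          (fun x hx g hg => (sub_eq_zero.1 (hdiff x z g hx hz hg)).symm) hp
      have hψ0 : ψ g = 0 := by
        refine hψadd.eq_zero_of_closure ?_ hg
        intro v hv
        obtain ⟨x, hx, y, hy, rfl⟩ := (hα.mem_valuesOn_comm hβ hVW).1 hv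
        refine ihα (fun p => ψ (p * y * p⁻¹ * y⁻¹))
          (hψadd.comm_left (fun p hp => comm_mem_of_mem_closure_left
            (fun x hx => hmemH x hx y hy) hp) hψinv) (hψfin.subset ?_) x
          (Subgroup.subset_closure hx)
        rintro _ ⟨p, hp, rfl⟩
        exact ⟨_, hmem p hp y hy, rfl⟩
      exact (sub_eq_zero.1 hψ0).symm
    intro g hg
    refine hφ.eq_zero_of_closure ?_ hg
    intro v hv
    obtain ⟨x, hx, y, hy, rfl⟩ := (hα.mem_valuesOn_comm hβ hVW).1 hv
    -- Invariance under the subgroup of β now makes φ([x, q]) additive in `q`.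
    refine ihβ (fun q => φ (x * q * x⁻¹ * q⁻¹))
      (hφ.comm_right (fun q hq => comm_mem_of_mem_closure_right (fun y hy => hmemH x hx y hy) hq)
        (fun q hq => invariant_of_closure hinv hq)) (hfin.subset ?_) y (Subgroup.subset_closure hy)
    rintro _ ⟨q, hq, rfl⟩
    exact ⟨_, hmem x hx q hq, rfl⟩

end AdditiveFunctions

/-! ### Reduction of finiteness to homomorphisms -/

section Finiteness

variable {G : Type*} [Group G]

/-- A commutator [a, b] depends only on how `a` and `b` permute `s` by conjugation. -/
theorem finite_commutatorSet_closure {s : Set G} (hs : s.Finite)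
    (hconj : ∀ g, ∀ x ∈ s, g * x * g⁻¹ ∈ s) : Finite (commutatorSet (Subgroup.closure s)) := by
  have := hs.to_subtype
  let q : Subgroup.closure s → s → s := fun h x => ⟨h * x * (h : G)⁻¹, hconj h x x.2⟩
  have hq : ∀ a b, q a = q b → ∀ c ∈ Subgroup.closure s,
      (a : G) * c * (a : G)⁻¹ = b * c * (b : G)⁻¹ := by
    intro a b hab c hc
    have : Subgroup.closure s ≤
        (MulAut.conj (a : G)).toMonoidHom.eqLocus (MulAut.conj (b : G)).toMonoidHom := by
      rw [Subgroup.closure_le]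
      intro x hx
      exact congrArg Subtype.val (congrFun hab ⟨x, hx⟩)
    exact this hc
  let r : Set.range q → Subgroup.closure s := fun a => a.2.choose
  have hr : ∀ a, q (r a) = a := fun a => a.2.choose_spec
  refine Set.Finite.to_subtype ((Set.finite_range
    fun p : Set.range q × Set.range q => r p.1 * r p.2 * (r p.1)⁻¹ * (r p.2)⁻¹).subset ?_)
  rintro _ ⟨a, b, rfl⟩
  refine ⟨(⟨q a, a, rfl⟩, ⟨q b, b, rfl⟩), ?_⟩
  set a' := r ⟨q a, a, rfl⟩
  set b' := r ⟨q b, b, rfl⟩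
  have ha : q a' = q a := hr _
  have hb : q b' = q b := hr _
  apply Subtype.ext
  have h1 := hq _ _ ha b' b'.2
  have h2 := hq _ _ hb (a : G)⁻¹ (inv_mem a.2)
  simp only [commutatorElement_def, Subgroup.coe_mul, Subgroup.coe_inv]
  rw [h1, mul_assoc, mul_assoc, ← mul_assoc _ (a : G)⁻¹, h2]
  group

/-- A subgroup generated by a finite normal subset is finite as soon as all its homomorphisms to
torsion-free abelian groups vanish. -/
theorem finite_closure_of_forall_eq_zero {G : Type v} [Group G] {s : Set G} (hs : s.Finite)
    (hconj : ∀ g, ∀ x ∈ s, g * x * g⁻¹ ∈ s)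
    (h : ∀ (T : Type v) [AddCommGroup T] [IsAddTorsionFree T] (φ : G → T),
      IsAdditiveOn (Subgroup.closure s) φ → ∀ g ∈ Subgroup.closure s, φ g = 0) :
    Finite (Subgroup.closure s) := by
  classical
  have := finite_commutatorSet_closure hs hconj
  have hfg : Group.FG (Subgroup.closure s) :=
    (Group.fg_iff_subgroup_fg _).2 ⟨hs.toFinset, by simp⟩
  set H := Subgroup.closure s
  have htors : IsMulTorsion (Abelianization H) := by
    intro a
    obtain ⟨a, rfl⟩ := QuotientGroup.mk_surjective a
    -- The target is torsion-free, so π is trivial and every class is torsion.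
    let π : H →* Abelianization H ⧸ CommGroup.torsion (Abelianization H) :=
      (QuotientGroup.mk' _).comp Abelianization.of
    have := h (Additive (Abelianization H ⧸ CommGroup.torsion (Abelianization H)))
      (fun g => if hg : g ∈ H then Additive.ofMul (π ⟨g, hg⟩) else 0)
      (fun a ha b hb => by
        simp only [ha, hb, H.mul_mem ha hb, dif_pos, ← ofMul_mul, ← map_mul]
        rfl) a a.2
    simp only [SetLike.coe_mem, dif_pos, ofMul_eq_zero] at this
    exact (QuotientGroup.eq_one_iff _).1 this
  have hfgab : Group.FG (Abelianization H) :=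
    Group.fg_of_surjective (f := Abelianization.of) QuotientGroup.mk_surjective
  have : Finite (H ⧸ commutator H) := CommGroup.finite_of_fg_isMulTorsion (Abelianization H) htors
  -- The derived subgroup is finite by Schur's theorem, as there are finitely many commutators.
  exact Finite.of_subgroup_quotient (commutator H)

end Finiteness

/-! ### Exponent sums -/

section NonCommutator

variable {X : Type*}

/-- The exponent sum of a word in the variable `x`. -/
def exponentSum [DecidableEq X] (x : X) : FreeGroup X →* Multiplicative ℤ :=
  FreeGroup.lift (Pi.mulSingle x (Multiplicative.ofAdd 1))

theorem lift_mulSingle [DecidableEq X] {G : Type*} [Group G] (x : X) (g : G) (w : FreeGroup X) :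
    FreeGroup.lift (Pi.mulSingle x g) w = g ^ (exponentSum x w).toAdd := by
  have : FreeGroup.lift (Pi.mulSingle x g) = (zpowersHom G g).comp (exponentSum x) := by
    ext y
    by_cases hy : y = x
    · subst hy; simp [exponentSum]
    · simp [exponentSum, hy]
  simp [this]

theorem IsNonCommutator.exists_exponentSum_ne [DecidableEq X] {w : FreeGroup X}
    (hw : IsNonCommutator w) : ∃ x, exponentSum x w ≠ 1 := by
  by_contra! hx
  refine hw ?_
  have key : ∀ x, (((Finsupp.applyAddHom x).comp
      (FreeAbelianGroup.toFinsupp (X := X))).toMultiplicative.comp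
        (Abelianization.of : FreeGroup X →* Abelianization (FreeGroup X))) = exponentSum x := by
    intro x
    ext y
    change (FreeAbelianGroup.toFinsupp (FreeAbelianGroup.of y)) x =
      (exponentSum x (FreeGroup.of y)).toAdd
    by_cases hy : y = x
    · subst hy; simp [exponentSum]
    · simp [exponentSum, hy]
  rw [← Abelianization.ker_of, MonoidHom.mem_ker]
  apply (FreeAbelianGroup.equivFinsupp X).injective
  ext x
  have := DFunLike.congr_fun (key x) w
  rw [hx x] at this
  exact this

/-- Substitute `g` for a variable of nonzero exponent sum and 1 for all others. -/
theorem IsNonCommutator.exists_zpow_mem_values {w : FreeGroup X} (hw : IsNonCommutator w) :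
    ∃ n : ℤ, n ≠ 0 ∧ ∀ (G : Type v) [Group G] (g : G), g ^ n ∈ values w G := by
  classical
  obtain ⟨x, hx⟩ := hw.exists_exponentSum_ne
  exact ⟨(exponentSum x w).toAdd, hx, fun G _ g => ⟨Pi.mulSingle x g, lift_mulSingle x g w⟩⟩

theorem isNonCommutator_of_zpow (x : X) {n : ℤ} (hn : n ≠ 0) :
    IsNonCommutator (FreeGroup.of x ^ n) := by
  classical
  intro h
  have h1 : exponentSum x (FreeGroup.of x ^ n) = 1 := Abelianization.commutator_subset_ker _ h
  have h2 : n • (1 : ℤ) = 0 := by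
    simpa [exponentSum] using congrArg Multiplicative.toAdd h1
  simp at h2
  exact hn h2

end NonCommutator

/-! ### Conciseness of the substituted word -/

section Substitution

theorem lift_lift {ι X G : Type*} [Group G] (z : ι → FreeGroup X) (g : X → G) (w : FreeGroup ι) :
    FreeGroup.lift g (FreeGroup.lift z w) =
      FreeGroup.lift (fun i => FreeGroup.lift g (z i)) w := by
  have : (FreeGroup.lift g).comp (FreeGroup.lift z) =
      FreeGroup.lift (fun i => FreeGroup.lift g (z i)) := by
    ext i; simp
  exact DFunLike.congr_fun this w

theorem conj_mem_values {X G : Type*} [Group G] (w : FreeGroup X) (g : G) {x : G}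
    (hx : x ∈ values w G) : g * x * g⁻¹ ∈ values w G := by
  obtain ⟨c, rfl⟩ := hx
  refine ⟨fun i => g * c i * g⁻¹, ?_⟩
  have h : FreeGroup.lift (fun i => g * c i * g⁻¹) =
      (MulAut.conj g).toMonoidHom.comp (FreeGroup.lift c) := by
    ext i; simp
  simp [h]

theorem lift_congr_of_mem_closure {X G : Type*} [Group G] {V : Set X} {w : FreeGroup X}
    (hw : w ∈ Subgroup.closure (FreeGroup.of '' V)) {c d : X → G} (h : ∀ x ∈ V, c x = d x) :
    FreeGroup.lift c w = FreeGroup.lift d w := by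
  have : Subgroup.closure (FreeGroup.of '' V) ≤
      (FreeGroup.lift c).eqLocus (FreeGroup.lift d) := by
    rw [Subgroup.closure_le]
    rintro _ ⟨x, hx, rfl⟩
    change FreeGroup.lift c _ = FreeGroup.lift d _
    simpa using h x hx
  exact this hw

/-- Values of words in disjoint sets of variables can be attained simultaneously. -/
theorem InDisjointVariables.values_lift {ι X G : Type*} [Group G] {z : ι → FreeGroup X}
    (hz : InDisjointVariables z) (w : FreeGroup ι) :
    values (FreeGroup.lift z w) G = valuesOn (fun i => values (z i) G) w := by
  classical
  obtain ⟨V, hV, hzV⟩ := hz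
  ext a
  constructor
  · rintro ⟨g, rfl⟩
    exact ⟨fun i => FreeGroup.lift g (z i), fun i => ⟨g, rfl⟩, (lift_lift z g w).symm⟩
  · rintro ⟨c, hc, rfl⟩
    choose d hd using hc
    let g : X → G := fun x => if h : ∃ i, x ∈ V i then d h.choose x else 1
    have hg : ∀ i, ∀ x ∈ V i, g x = d i x := by
      intro i x hx
      have h : ∃ i, x ∈ V i := ⟨i, hx⟩
      have hi : h.choose = i := by
        by_contra hne
        exact Set.disjoint_left.1 (hV hne) h.choose_spec hx
      simp only [g, dif_pos h, hi]
    refine ⟨g, ?_⟩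
    change FreeGroup.lift g (FreeGroup.lift z w) = _
    rw [lift_lift]
    congr 2
    funext i
    rw [← hd i]
    exact lift_congr_of_mem_closure (hzV i) (hg i)

theorem IsOuterCommutator.isConcise_lift {ι : Type*} {X : Type u} {V : Set ι} {w : FreeGroup ι}
    (hw : IsOuterCommutator V w) {z : ι → FreeGroup X} (hz : InDisjointVariables z)
    (hnc : ∀ i, IsNonCommutator (z i)) : IsConcise.{u, v} (FreeGroup.lift z w) := by
  intro G _ hfin
  choose n hn hpow using fun i => (hnc i).exists_zpow_mem_values
  unfold verbalSubgroup
  rw [hz.values_lift] at hfin ⊢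
  have hS : ∀ i (g : G), ∀ s ∈ values (z i) G, g * s * g⁻¹ ∈ values (z i) G :=
    fun i g s hs => conj_mem_values (z i) g hs
  refine finite_closure_of_forall_eq_zero hfin (fun g x hx => conj_mem_valuesOn hS w g hx) ?_
  intro T _ _ φ hφ
  refine hw.eq_zero_of_finite_image hS hn (fun i s _ k => ?_)
    (fun i => ⟨_, hpow i G 1⟩) φ hφ (hfin.image φ)
  rw [mul_comm, zpow_mul]
  exact hpow i G _

end Substitution

/-! ### From conciseness to bounded conciseness -/

section Bounded

/-- The kernel of the projection from a product of groups to the reduced product along a filter. -/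
def eventuallyOne {K : Type*} (l : Filter K) (G : K → Type*) [∀ k, Group (G k)] :
    Subgroup (∀ k, G k) where
  carrier := {f | ∀ᶠ k in l, f k = 1}
  one_mem' := by simp
  mul_mem' := by
    intro a b ha hb
    filter_upwards [ha, hb] with k h1 h2
    simp [h1, h2]
  inv_mem' := by
    intro a ha
    filter_upwards [ha] with k h1
    simp [h1]

instance {K : Type*} (l : Filter K) (G : K → Type*) [∀ k, Group (G k)] :
    (eventuallyOne l G).Normal where
  conj_mem a ha b := by
    filter_upwards [show ∀ᶠ k in l, a k = 1 from ha] with k h1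
    simp [h1]

theorem lift_pi_apply {ι K : Type*} {G : K → Type*} [∀ k, Group (G k)] (c : ι → ∀ k, G k)
    (w : FreeGroup ι) (k : K) :
    FreeGroup.lift c w k = FreeGroup.lift (fun i => c i k) w := by
  have : (Pi.evalMonoidHom G k).comp (FreeGroup.lift c) = FreeGroup.lift (fun i => c i k) := by
    ext i; simp
  exact DFunLike.congr_fun this w

theorem lift_mk_apply {ι H : Type*} [Group H] (N : Subgroup H) [N.Normal] (c : ι → H)
    (w : FreeGroup ι) :
    FreeGroup.lift (fun i => (c i : H ⧸ N)) w = (FreeGroup.lift c w : H) := by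
  have : (QuotientGroup.mk' N).comp (FreeGroup.lift c) =
      FreeGroup.lift (fun i => (c i : H ⧸ N)) := by
    ext i; simp
  exact (DFunLike.congr_fun this w).symm

theorem range_lift_eq_verbalSubgroup {ι X G : Type*} [Group G] {w : FreeGroup X} {e : ι → G}
    (he : Set.range e = values w G) : (FreeGroup.lift e).range = verbalSubgroup w G := by
  rw [FreeGroup.range_lift_eq_closure, he, verbalSubgroup]

/-- If the homomorphism from a finitely generated free group to an ultraproduct has finite image,
then almost all components have image of at most the same order. -/
theorem eventually_card_range_le {ι K : Type*} [Finite ι] (l : Filter K) {G : K → Type*}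
    [∀ k, Group (G k)] (e : ∀ k, ι → G k)
    (hfin : Finite (FreeGroup.lift
      (fun i => ((fun k => e k i : ∀ k, G k) : (∀ k, G k) ⧸ eventuallyOne l G))).range) :
    ∃ B : ℕ, ∀ᶠ k in l, Nat.card (FreeGroup.lift (e k)).range ≤ B := by
  set Φ := FreeGroup.lift
    (fun i => ((fun k => e k i : ∀ k, G k) : (∀ k, G k) ⧸ eventuallyOne l G)) with hΦ
  have hker : Φ.ker.FiniteIndex := Subgroup.finiteIndex_ker Φ
  -- By Schreier, finitely many relations define the image, so they hold simultaneously in almost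
  -- all components.
  have hfg : Group.FG Φ.ker := Subgroup.fg_of_index_ne_zero _
  obtain ⟨t, ht⟩ := (Group.fg_iff_subgroup_fg _).1 hfg
  have hev : ∀ᶠ k in l, ∀ a ∈ t, FreeGroup.lift (e k) a = 1 := by
    rw [Filter.eventually_all_finset]
    intro a ha
    have h1 : Φ a = 1 := MonoidHom.mem_ker.1 (ht ▸ Subgroup.subset_closure ha)
    rw [hΦ, lift_mk_apply, QuotientGroup.eq_one_iff] at h1
    filter_upwards [show ∀ᶠ k in l, _ = _ from h1] with k hk
    rwa [lift_pi_apply] at hk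
  refine ⟨Φ.ker.index, ?_⟩
  filter_upwards [hev] with k hk
  have hle : Φ.ker ≤ (FreeGroup.lift (e k)).ker := by
    rw [← ht, Subgroup.closure_le]
    exact fun a ha => MonoidHom.mem_ker.2 (hk a ha)
  rw [← Subgroup.index_ker]
  exact Nat.le_of_dvd (Nat.pos_of_ne_zero hker.index_ne_zero) (Subgroup.index_dvd_of_le hle)

/-- If no bound exists for `m` values, take groups `G k` with |w(G k)| > k; their ultraproduct has
at most `m` values, so conciseness bounds almost all |w(G k)|. -/
theorem IsConcise.isBoundedlyConcise {X : Type u} {w : FreeGroup X} (hw : IsConcise.{u, v} w) :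
    IsBoundedlyConcise.{u, v} w := by
  suffices h : ∀ m : ℕ, ∃ B : ℕ, ∀ (G : Type v) [Group G], (values w G).Finite →
      (values w G).ncard = m → Nat.card (verbalSubgroup w G) ≤ B by
    choose f hf using h
    exact ⟨f, fun G _ hG => ⟨hw G hG, hf _ G hG rfl⟩⟩
  intro m
  by_contra! h
  choose G inst hfin hcard hlt using h
  have he : ∀ k, ∃ e : Fin m → G k, Set.range e = values w (G k) := by
    intro k
    have := (hfin k).to_subtype
    let E := Finite.equivFinOfCardEq ((Nat.card_coe_set_eq _).trans (hcard k))
    exact ⟨Subtype.val ∘ E.symm, by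
      rw [E.symm.surjective.range_comp Subtype.val, Subtype.range_coe]⟩
  choose e he using he
  let U : Ultrafilter ℕ := Filter.hyperfilter ℕ
  let e' : Fin m → (∀ k, G k) ⧸ eventuallyOne (U : Filter ℕ) G :=
    fun i => ((fun k => e k i : ∀ k, G k) : (∀ k, G k) ⧸ eventuallyOne (U : Filter ℕ) G)
  have he' : Set.range e' = values w ((∀ k, G k) ⧸ eventuallyOne (U : Filter ℕ) G) := by
    ext a
    constructor
    · rintro ⟨i, rfl⟩
      have hi : ∀ k, ∃ c : X → G k, FreeGroup.lift c w = e k i := fun k => by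
        have : e k i ∈ values w (G k) := he k ▸ ⟨i, rfl⟩
        exact this
      choose c hc using hi
      refine ⟨fun x => ((fun k => c k x : ∀ k, G k) : _ ⧸ _), ?_⟩
      change FreeGroup.lift _ w = _
      rw [lift_mk_apply]
      congr 1
      funext k
      rw [lift_pi_apply, hc]
    · rintro ⟨c, rfl⟩
      choose d hd using fun x => QuotientGroup.mk_surjective (c x)
      obtain rfl : (fun x => (d x : _ ⧸ eventuallyOne (U : Filter ℕ) G)) = c := funext hd
      have hi : ∀ k, ∃ i, e k i = FreeGroup.lift (fun x => d x k) w := fun k => by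
        have : FreeGroup.lift (fun x => d x k) w ∈ values w (G k) := ⟨_, rfl⟩
        rwa [← he k] at this
      -- The ultrafilter selects one of the finitely many indices for almost all `k`.
      have hU : ∃ i, ∀ᶠ k in (U : Filter ℕ), e k i = FreeGroup.lift (fun x => d x k) w :=
        Ultrafilter.eventually_exists_iff.1 (Filter.Eventually.of_forall hi)
      obtain ⟨i, hi⟩ := hU
      refine ⟨i, ?_⟩
      change _ = FreeGroup.lift _ w
      rw [lift_mk_apply, QuotientGroup.eq]
      change ∀ᶠ k in (U : Filter ℕ), _
      filter_upwards [hi] with k hk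
      simp [lift_pi_apply, hk]
  have hF : Finite (FreeGroup.lift e').range := by
    rw [range_lift_eq_verbalSubgroup he']
    exact hw _ (he' ▸ Set.finite_range e')
  obtain ⟨B, hB⟩ := eventually_card_range_le (U : Filter ℕ) e hF
  have hlarge : ∀ᶠ k in (U : Filter ℕ), B ≤ k :=
    Nat.hyperfilter_le_atTop (Filter.eventually_ge_atTop B)
  obtain ⟨k, hk1, hk2⟩ := (hB.and hlarge).exists
  rw [range_lift_eq_verbalSubgroup (he k)] at hk1
  have := hlt k
  omega

end Bounded

end GroupWord

theorem theoremA {r : ℕ} (w : FreeGroup (Fin r))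
    (hw : GroupWord.IsOuterCommutator Set.univ w) :
    (∀ (X : Type u) (z : Fin r → FreeGroup X), GroupWord.InDisjointVariables z →
      (∀ i, GroupWord.IsNonCommutator (z i)) →
        GroupWord.IsConcise.{u, v} (FreeGroup.lift z w) ∧
        GroupWord.IsBoundedlyConcise.{u, v} (FreeGroup.lift z w)) ∧
    (∀ n : Fin r → ℤ, (∀ i, n i ≠ 0) →
      GroupWord.IsConcise.{0, v} (FreeGroup.lift (fun i => FreeGroup.of i ^ n i) w) ∧
      GroupWord.IsBoundedlyConcise.{0, v} (FreeGroup.lift (fun i => FreeGroup.of i ^ n i) w)) := by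
  refine ⟨fun X z hz hnc => ?_, fun n hn => ?_⟩
  · have h := hw.isConcise_lift hz hnc
    exact ⟨h, h.isBoundedlyConcise⟩
  · have hz : GroupWord.InDisjointVariables fun i : Fin r => FreeGroup.of i ^ n i := by
      refine ⟨fun i => {i}, fun i j hij => Set.disjoint_singleton.2 hij, fun i => ?_⟩
      have hi : FreeGroup.of i ∈ Subgroup.closure (FreeGroup.of '' ({i} : Set (Fin r))) :=
        Subgroup.subset_closure (Set.mem_image_of_mem _ (Set.mem_singleton i))
      exact Subgroup.zpow_mem _ hi (n i)
    have h := hw.isConcise_lift hz fun i => GroupWord.isNonCommutator_of_zpow i (hn i)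
    exact ⟨h, h.isBoundedlyConcise⟩
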